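/- Let $X$ be a non-empty compact metric space satisfying $(\star)$ each non-trivial (i.e. more than one-point) connected component of $X$ is an arc $[a,b]$, i.e. a homeomorphic image of a closed interval with endpoints $a,b$, and $(a,b)=[a,b]\setminus\{a,b\}$ is open in $X$. An endpoint $e$ of a non-trivial component $I$ of a space $Y$ satisfying $(\star)$ is called *free* if $e$ lies in the interior of $I$ with respect to $Y$. For a compact $K\subseteq\mathbb R$ (such a set always satisfies $(\star)$), a *$K$-gap* is a component of $\mathbb R\setminus K$ (bounded or not) and a *$K$-interval* is a non-trivial component of $K$. An *L-Cantorval* is a non-empty compact set $K\subseteq\mathbb R$ such that, for every $K$-gap $G$: if $b=\sup G<\infty$, then $b$ is the left endpoint of some $K$-interval; and if $a=\inf G>-\infty$, then for every $\varepsilon>0$ the interval $(a-\varepsilon,a)$ contains infinitely many $K$-intervals and infinitely many $K$-gaps. An L-Cantorval is *special* if each of its $K$-intervals has its left endpoint free. Suppose that the union of all non-trivial components of $X$ is dense in $X$ and that each non-trivial component of $X$ has exactly one free endpoint. Then $X$ is homeomorphic to the special L-Cantorval; that is, special L-Cantorvals exist, and $X$ is homeomorphic to every special L-Cantorval. -/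

import Mathlib

open Set Topology

namespace SpecialCantorval

section Components

variable {X : Type*} [TopologicalSpace X]

/-- `S` is an arc with endpoints `a` and `b`: a homeomorphic image of `[0, 1]` under a map
sending `0` to `a` and `1` to `b`. -/
def IsArc (S : Set X) (a b : X) : Prop :=
  ∃ γ : unitInterval → X, IsEmbedding γ ∧ range γ = S ∧ γ 0 = a ∧ γ 1 = b

/-- `S` is a non-trivial (more than one point) connected component of the space `X`. -/
def IsNontrivialComponent (S : Set X) : Prop :=
  (∃ x : X, connectedComponent x = S) ∧ S.Nontrivial

/-- Condition `(⋆)`: each non-trivial component of `X` is an arc `[a, b]` such that the set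
`(a, b) = [a, b] \ {a, b}` is open in `X`. -/
def ConditionStar (X : Type*) [TopologicalSpace X] : Prop :=
  ∀ S : Set X, IsNontrivialComponent S → ∃ a b : X, IsArc S a b ∧ IsOpen (S \ {a, b})

/-- `e` is a free endpoint of the arc `S` in the space `X`: an endpoint that lies in the interior
of `S` with respect to `X`. It is only used for non-trivial components of spaces that satisfy `(⋆)`
(every compact subset of the reals does). Since an arc can be traversed backwards, taking `e` as
the first endpoint is no restriction. -/
def IsFreeEndpoint (S : Set X) (e : X) : Prop :=
  (∃ b : X, IsArc S e b) ∧ e ∈ interior S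

end Components

/-- A `K`-gap: a component of `ℝ \ K` (the two unbounded ones are included). -/
def IsGap (K G : Set ℝ) : Prop :=
  ∃ x ∈ Kᶜ, connectedComponentIn Kᶜ x = G

/-- A `K`-interval: a non-trivial component of `K`. -/
def IsInterval (K J : Set ℝ) : Prop :=
  (∃ x ∈ K, connectedComponentIn K x = J) ∧ J.Nontrivial

/-- An L-Cantorval: a non-empty compact set of reals such that any gap has an interval adjacent to
its right and is accumulated on the left by infinitely many intervals and gaps. For the gap
unbounded to the right (left) only the condition at its left (right) end makes sense: a set that is
not bounded above has no least upper bound, and likewise below. -/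
structure IsLCantorval (K : Set ℝ) : Prop where
  nonempty : K.Nonempty
  isCompact : IsCompact K
  right : ∀ G, IsGap K G → ∀ b, IsLUB G b → ∃ J, IsInterval K J ∧ IsLeast J b
  left : ∀ G, IsGap K G → ∀ a, IsGLB G a → ∀ ε > 0,
    {J | IsInterval K J ∧ J ⊆ Ioo (a - ε) a}.Infinite ∧
    {H | IsGap K H ∧ H ⊆ Ioo (a - ε) a}.Infinite

/-- A special L-Cantorval: each `K`-interval has its left endpoint free (in the space `K`). -/
structure IsSpecialLCantorval (K : Set ℝ) : Prop extends IsLCantorval K where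
  left_free : ∀ J, IsInterval K J →
    ∃ a : K, IsLeast J (a : ℝ) ∧ IsFreeEndpoint ((↑) ⁻¹' J : Set K) a

end SpecialCantorval

/-! Every space satisfying the hypotheses is homeomorphic to one concrete model, `hairyCantor`: the
Cantor space with a segment ("hair") at each eventually `false` sequence, only finitely many hairs
exceeding any given length. It then remains to see that special L-Cantorvals satisfy the hypotheses
and that one exists.

Collapsing the components of `X` gives a Cantor space in which the non-trivial components form a
countable dense set. They are countable because free endpoints give them non-empty disjoint
interiors. No non-empty clopen set is connected, since it would be a non-trivial component, and such
a component is not open at its non-free endpoint. `exists_address` chooses the coordinates so that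
the dense set becomes the eventually `false` sequences. The second coordinate is the height along
each arc, measured from the non-free endpoint and scaled to the hair
(`IsHairySpace.exists_closedEmbedding`).

In a special L-Cantorval, the condition to the right of gaps yields density and the one to their
left makes right endpoints non-free (`IsSpecialLCantorval.isHairySpace`). For existence, the model
is laid out on the line along a ternary Cantor set, each hair pointing left and short enough to fit
into the gap there (`layout_lt_layout`). -/

namespace SpecialCantorval

/-! ### Coding the components by binary sequences -/

section Coding

variable {X : Type*}

/-- The clopen-tree node reached along `s` when every node `P` is split into the part `L P`
(digit `false`) and the rest (digit `true`). -/
def cylinder (L : Set X → Set X) (s : ℕ → Bool) : ℕ → Set X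
  | 0 => univ
  | n + 1 => bif s n then cylinder L s n \ L (cylinder L s n) else L (cylinder L s n)

theorem cylinder_congr (L : Set X → Set X) {s t : ℕ → Bool} {n : ℕ} (h : ∀ i < n, s i = t i) :
    cylinder L s n = cylinder L t n := by
  induction n with
  | zero => rfl
  | succ n ih =>
    simp only [cylinder, ih fun i hi => h i (hi.trans n.lt_succ_self), h n n.lt_succ_self]

theorem exists_mem_cylinder (L : Set X → Set X) (x : X) : ∃ s, ∀ n, x ∈ cylinder L s n := by
  classical
  let A : ℕ → Set X := fun n =>
    Nat.rec univ (fun _ P => if x ∈ L P then L P else P \ L P) n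
  have hA : ∀ n, x ∈ A n := by
    intro n
    induction n with
    | zero => trivial
    | succ n ih =>
      by_cases h : x ∈ L (A n)
      · change x ∈ if x ∈ L (A n) then L (A n) else A n \ L (A n)
        rwa [if_pos h]
      · change x ∈ if x ∈ L (A n) then L (A n) else A n \ L (A n)
        rw [if_neg h]
        exact ⟨ih, h⟩
  refine ⟨fun n => decide (x ∉ L (A n)), fun n => ?_⟩
  suffices cylinder L (fun n => decide (x ∉ L (A n))) n = A n from this ▸ hA n
  induction n with
  | zero => rfl
  | succ n ih =>
    change _ = if x ∈ L (A n) then L (A n) else A n \ L (A n)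
    rw [cylinder, ih]
    by_cases h : x ∈ L (A n) <;> simp [h]

variable {L : Set X → Set X}

theorem eq_of_mem_cylinder (hL : ∀ s n, L (cylinder L s n) ⊆ cylinder L s n) {s t : ℕ → Bool}
    {x : X} {n : ℕ} (hs : x ∈ cylinder L s n) (ht : x ∈ cylinder L t n) : ∀ i < n, s i = t i := by
  induction n with
  | zero => intro i hi; omega
  | succ n ih =>
    have sub : ∀ s, cylinder L s (n + 1) ⊆ cylinder L s n := by
      intro s
      rw [cylinder]
      cases s n
      · exact hL s n
      · exact sdiff_subset
    have ih' := ih (sub s hs) (sub t ht)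
    intro i hi
    rcases Nat.lt_succ_iff_lt_or_eq.1 hi with hi | rfl
    · exact ih' i hi
    · rw [cylinder] at hs ht
      rw [← cylinder_congr L ih'] at ht
      cases h1 : s i <;> cases h2 : t i <;> simp_all

/-- `V` meets both `P` and its complement in `P`. -/
def Splits (V P : Set X) : Prop := (P ∩ V).Nonempty ∧ (P \ V).Nonempty

theorem Splits.mono {V P Q : Set X} (h : Splits V P) (hPQ : P ⊆ Q) : Splits V Q :=
  ⟨h.1.mono (inter_subset_inter_left _ hPQ), h.2.mono (sdiff_subset_sdiff_left hPQ)⟩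

/-- A rule choosing one half of each set: the half, with respect to the first `U k` that splits
the set, which contains the first point `p j` of the set. -/
theorem exists_halving (U : ℕ → Set X) (p : ℕ → X) : ∃ L : Set X → Set X, ∀ P,
    (∃ k, Splits (U k) P) → (∃ j, p j ∈ P) →
    (∃ k, Splits (U k) P ∧ (∀ m < k, ¬ Splits (U m) P) ∧ (L P = P ∩ U k ∨ L P = P \ U k)) ∧
    ∀ j, p j ∈ P → (∀ i < j, p i ∉ P) → p j ∈ L P := by
  classical
  have : ∀ P : Set X, ∃ Q : Set X, (∃ k, Splits (U k) P) → (∃ j, p j ∈ P) →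
      (∃ k, Splits (U k) P ∧ (∀ m < k, ¬ Splits (U m) P) ∧ (Q = P ∩ U k ∨ Q = P \ U k)) ∧
      ∀ j, p j ∈ P → (∀ i < j, p i ∉ P) → p j ∈ Q := by
    intro P
    by_cases hk : ∃ k, Splits (U k) P
    swap
    · exact ⟨P, fun h => absurd h hk⟩
    by_cases hj : ∃ j, p j ∈ P
    swap
    · exact ⟨P, fun _ h => absurd h hj⟩
    have key : ∀ j, p j ∈ P → (∀ i < j, p i ∉ P) → j = Nat.find hj := fun j h1 h2 =>
      ((Nat.find_eq_iff hj).2 ⟨h1, h2⟩).symm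
    by_cases h : p (Nat.find hj) ∈ U (Nat.find hk)
    · refine ⟨P ∩ U (Nat.find hk), fun _ _ => ⟨⟨_, Nat.find_spec hk, fun m => Nat.find_min hk,
        Or.inl rfl⟩, fun j h1 h2 => ⟨h1, ?_⟩⟩⟩
      rwa [key j h1 h2]
    · refine ⟨P \ U (Nat.find hk), fun _ _ => ⟨⟨_, Nat.find_spec hk, fun m => Nat.find_min hk,
        Or.inr rfl⟩, fun j h1 h2 => ⟨h1, ?_⟩⟩⟩
      rwa [key j h1 h2]
  choose L hL using this
  exact ⟨L, hL⟩

/-- In a compact space, any countable set `range p` that meets every non-empty clopen set, in which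
no clopen set is connected, is mapped onto the eventually `false` sequences by some continuous
surjection onto the Cantor space whose fibres are the connected components. -/
theorem exists_address [TopologicalSpace X] [CompactSpace X] [T2Space X] (U : ℕ → Set X)
    (hU : ∀ k, IsClopen (U k)) (hU' : ∀ V : Set X, IsClopen V → ∃ k, U k = V) (p : ℕ → X)
    (hp : ∀ P : Set X, IsClopen P → P.Nonempty → ∃ j, p j ∈ P)
    (hsplit : ∀ P : Set X, IsClopen P → P.Nonempty → ¬ IsPreconnected P) [Nonempty X]
    (hpc : ∀ i j, connectedComponent (p i) = connectedComponent (p j) → p i = p j) :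
    ∃ φ : X → ℕ → Bool, Continuous φ ∧ Function.Surjective φ ∧
      (∀ x y, φ x = φ y ↔ connectedComponent x = connectedComponent y) ∧
      ∀ s, (∃ n, ∀ k ≥ n, s k = false) ↔ ∃ j, φ (p j) = s := by
  have hsplit' : ∀ P : Set X, IsClopen P → P.Nonempty → ∃ k, Splits (U k) P := by
    intro P hP hne
    have := hsplit P hP hne
    rw [isPreconnected_iff_subset_of_disjoint] at this
    push Not at this
    obtain ⟨u, v, hu, hv, hPuv, hd, h1, h2⟩ := this
    have hc : IsClopen (P ∩ u) := by
      refine ⟨?_, hP.2.inter hu⟩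
      have : P ∩ u = P ∩ vᶜ := by
        ext x
        constructor
        · rintro ⟨hx, hxu⟩
          exact ⟨hx, fun hxv => (hd.subset ⟨hx, hxu, hxv⟩ : x ∈ (∅ : Set X))⟩
        · rintro ⟨hx, hxv⟩
          exact ⟨hx, (hPuv hx).resolve_right hxv⟩
      rw [this]
      exact hP.1.inter hv.isClosed_compl
    obtain ⟨k, hk⟩ := hU' _ hc
    refine ⟨k, ?_, ?_⟩
    · obtain ⟨x, hx, hxv⟩ := not_subset.1 h2
      exact ⟨x, hx, hk ▸ ⟨hx, (hPuv hx).resolve_right hxv⟩⟩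
    · obtain ⟨x, hx, hxu⟩ := not_subset.1 h1
      exact ⟨x, hx, hk ▸ fun h => hxu h.2⟩
  obtain ⟨L, hL⟩ := exists_halving U p
  have hhalf : ∀ P : Set X, IsClopen P → P.Nonempty →
      IsClopen (L P) ∧ (L P).Nonempty ∧ L P ⊆ P ∧ (P \ L P).Nonempty := by
    intro P hP hne
    obtain ⟨⟨k, hk, -, h | h⟩, -⟩ := hL P (hsplit' P hP hne) (hp P hP hne)
    · rw [h]
      exact ⟨hP.inter (hU k), hk.1, inter_subset_left, by simpa using hk.2⟩
    · rw [h]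
      exact ⟨hP.diff (hU k), hk.2, sdiff_subset, by simpa using hk.1⟩
  have hcyl : ∀ s n, IsClopen (cylinder L s n) ∧ (cylinder L s n).Nonempty := by
    intro s n
    induction n with
    | zero => exact ⟨isClopen_univ, univ_nonempty⟩
    | succ n ih =>
      obtain ⟨h1, h2, h3, h4⟩ := hhalf _ ih.1 ih.2
      rw [cylinder]
      cases s n
      · exact ⟨h1, h2⟩
      · exact ⟨ih.1.diff h1, h4⟩
  have hLs : ∀ s n, L (cylinder L s n) ⊆ cylinder L s n := fun s n =>
    (hhalf _ (hcyl s n).1 (hcyl s n).2).2.2.1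
  have hsub : ∀ s n, cylinder L s (n + 1) ⊆ cylinder L s n := by
    intro s n
    rw [cylinder]
    cases s n
    · exact hLs s n
    · exact sdiff_subset
  have hanti : ∀ s, Antitone (cylinder L s) := fun s => antitone_nat_of_succ_le (hsub s)
  -- Each level removes the first remaining splitter: if `U m` still splits the cylinder at level
  -- `m`, it is the set used to halve it, so neither half is split by it.
  have hunsplit : ∀ s n, ∀ m < n, ¬ Splits (U m) (cylinder L s n) := by
    intro s n
    induction n with
    | zero => intro m hm; omega
    | succ n ih =>
      intro m hm hsp
      rcases Nat.lt_succ_iff_lt_or_eq.1 hm with hm | rfl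
      · exact ih m hm (hsp.mono (hsub s n))
      · obtain ⟨⟨k, hk, hkm, hor⟩, -⟩ := hL _ (hsplit' _ (hcyl s m).1 (hcyl s m).2)
          (hp _ (hcyl s m).1 (hcyl s m).2)
        have hmk : k = m := by
          rcases lt_trichotomy k m with h | h | h
          · exact absurd hk (ih k h)
          · exact h
          · exact absurd (hsp.mono (hsub s m)) (hkm m h)
        subst hmk
        obtain ⟨⟨x, hx, hxU⟩, ⟨y, hy, hyU⟩⟩ := hsp
        rw [cylinder] at hx hy
        rcases hor with h | h <;> rw [h] at hx hy <;> cases hs : s k <;> simp_all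
  choose φ hφ using exists_mem_cylinder L
  have huniq : ∀ x s, (∀ n, x ∈ cylinder L s n) → φ x = s := fun x s h => funext fun i =>
    eq_of_mem_cylinder hLs (hφ x (i + 1)) (h (i + 1)) i i.lt_succ_self
  have hloc : ∀ x n y, y ∈ cylinder L (φ x) n → ∀ i < n, φ y i = φ x i := fun x n y hy =>
    eq_of_mem_cylinder hLs (hφ y n) hy
  have hfib : ∀ x y, φ x = φ y ↔ connectedComponent x = connectedComponent y := by
    intro x y
    constructor
    · intro h
      refine connectedComponent_eq ?_
      rw [connectedComponent_eq_iInter_isClopen x]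
      refine mem_iInter.2 fun V => ?_
      obtain ⟨k, hk⟩ := hU' V.1 V.2.1
      by_contra hy
      refine hunsplit (φ x) (k + 1) k k.lt_succ_self ⟨⟨x, hφ x _, hk ▸ V.2.2⟩, ⟨y, ?_, hk ▸ hy⟩⟩
      rw [h]
      exact hφ y _
    · intro h
      refine (huniq y _ fun n => ?_).symm
      have := (hcyl (φ x) n).1.connectedComponent_subset (hφ x n)
      rw [h] at this
      exact this mem_connectedComponent
  refine ⟨φ, ?_, ?_, hfib, ?_⟩
  · refine continuous_pi fun n => continuous_iff_continuousAt.2 fun x => ?_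
    refine ContinuousAt.congr (f := fun _ => φ x n) continuousAt_const ?_
    filter_upwards [(hcyl (φ x) (n + 1)).1.2.mem_nhds (hφ x _)] with y hy
    exact (hloc x _ y hy n n.lt_succ_self).symm
  · intro s
    obtain ⟨x, hx⟩ := IsCompact.nonempty_iInter_of_sequence_nonempty_isCompact_isClosed
      (cylinder L s) (hsub s) (fun n => (hcyl s n).2) (hcyl s 0).1.1.isCompact
      (fun n => (hcyl s n).1.1)
    exact ⟨x, huniq x s (mem_iInter.1 hx)⟩
  · intro s
    constructor
    · rintro ⟨N, hN⟩
      classical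
      -- From level `N` on every digit selects the half containing the first listed point, so the
      -- first point of the cylinder at level `N` is never lost.
      have hj := hp _ (hcyl s N).1 (hcyl s N).2
      refine ⟨Nat.find hj, huniq _ _ fun n => ?_⟩
      suffices ∀ n ≥ N, p (Nat.find hj) ∈ cylinder L s n from
        hanti s (le_max_left n N) (this _ (le_max_right n N))
      intro n hn
      induction n, hn using Nat.le_induction with
      | base => exact Nat.find_spec hj
      | succ n hn ih =>
        rw [cylinder, hN n hn]
        exact (hL _ (hsplit' _ (hcyl s n).1 (hcyl s n).2) ⟨_, ih⟩).2 _ ih fun i hi hmem =>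
          Nat.find_min hj hi (hanti s hn hmem)
    · rintro ⟨j₀, rfl⟩
      classical
      have hex : ∃ j, p j = p j₀ := ⟨j₀, rfl⟩
      -- The list may repeat points, so the first index is taken. The finitely many earlier points
      -- lie in other components and eventually leave the cylinders; from then on `p j` is the first
      -- point and its digits are `false`.
      obtain ⟨j, hj, hjmin⟩ : ∃ j, p j = p j₀ ∧ ∀ i < j, p i ≠ p j₀ :=
        ⟨Nat.find hex, Nat.find_spec hex, fun i => Nat.find_min hex⟩
      rw [← hj] at hjmin ⊢
      have hsep : ∀ i < j, ∃ n, p i ∉ cylinder L (φ (p j)) n := by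
        intro i hi
        by_contra! h
        exact hjmin i hi (hpc _ _ ((hfib _ _).1 (huniq _ _ h)))
      choose! N hN using hsep
      refine ⟨(Finset.range j).sup N, fun k hk => ?_⟩
      have hmem := (hL _ (hsplit' _ (hcyl (φ (p j)) k).1 (hcyl (φ (p j)) k).2) ⟨j, hφ _ _⟩).2 j
        (hφ _ _) fun i hi hmem => hN i hi
          (hanti _ ((Finset.le_sup (Finset.mem_range.2 hi)).trans hk) hmem)
      have := hφ (p j) (k + 1)
      rw [cylinder] at this
      cases h : φ (p j) k
      · rfl
      · rw [h] at this
        exact absurd hmem this.2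

end Coding

theorem countable_clopens (X : Type*) [TopologicalSpace X] [CompactSpace X]
    [SecondCountableTopology X] : {V : Set X | IsClopen V}.Countable := by
  have : ∀ V : {V : Set X | IsClopen V}, ∃ t : Finset (TopologicalSpace.countableBasis X),
      V.1 = (SetLike.coe t).sUnion := fun V =>
    eq_sUnion_finset_of_isTopologicalBasis_of_isCompact_open _
      (TopologicalSpace.isBasis_countableBasis X) V.1 V.2.1.isCompact V.2.2
  choose f hf using this
  have hinj : Function.Injective f := fun V W h => Subtype.ext (by rw [hf V, hf W, h])
  exact hinj.countable

/-! ### Arcs and their endpoints -/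

section Arcs

variable {X : Type*} [TopologicalSpace X]

theorem IsArc.symm {S : Set X} {a b : X} (h : IsArc S a b) : IsArc S b a := by
  obtain ⟨γ, hγ, hS, ha, hb⟩ := h
  refine ⟨γ ∘ unitInterval.symm, hγ.comp unitInterval.symmHomeomorph.isEmbedding, ?_, ?_, ?_⟩
  · rw [unitInterval.symm_involutive.surjective.range_comp, hS]
  · simpa using hb
  · simpa using ha

/-- Two parametrizations differ by a self-homeomorphism of the unit interval, which is strictly
monotone and so fixes or swaps the ends. -/
theorem IsArc.endpoints_eq {S : Set X} {a b c d : X} (h : IsArc S a b) (h' : IsArc S c d) :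
    (a = c ∧ b = d) ∨ (a = d ∧ b = c) := by
  obtain ⟨γ, hγ, hS, rfl, rfl⟩ := h
  obtain ⟨δ, hδ, hS', rfl, rfl⟩ := h'
  subst hS
  let σ : unitInterval ≃ₜ unitInterval :=
    hγ.toHomeomorph.trans ((Homeomorph.setCongr hS'.symm).trans hδ.toHomeomorph.symm)
  have hσ : ∀ t, δ (σ t) = γ t := by
    intro t
    have : hδ.toHomeomorph (σ t) = Homeomorph.setCongr hS'.symm (hγ.toHomeomorph t) := by
      simp [σ]
    exact congrArg Subtype.val this
  have h0 := hσ 0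
  have h1 := hσ 1
  obtain ⟨t0, ht0⟩ := σ.surjective 0
  obtain ⟨t1, ht1⟩ := σ.surjective 1
  rcases σ.continuous.strictMono_of_inj σ.injective with hm | hm
  · have e0 : σ 0 = 0 :=
      le_antisymm ((hm.monotone (unitInterval.nonneg' (t := t0))).trans_eq ht0) unitInterval.nonneg'
    have e1 : σ 1 = 1 :=
      le_antisymm unitInterval.le_one' (ht1.ge.trans (hm.monotone (unitInterval.le_one' (t := t1))))
    rw [e0] at h0
    rw [e1] at h1
    exact Or.inl ⟨h0.symm, h1.symm⟩
  · have e0 : σ 0 = 1 :=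
      le_antisymm unitInterval.le_one' (ht1.ge.trans (hm.antitone (unitInterval.nonneg' (t := t1))))
    have e1 : σ 1 = 0 :=
      le_antisymm ((hm.antitone (unitInterval.le_one' (t := t0))).trans_eq ht0) unitInterval.nonneg'
    rw [e0] at h0
    rw [e1] at h1
    exact Or.inr ⟨h0.symm, h1.symm⟩

theorem IsArc.ne {S : Set X} {a b : X} (h : IsArc S a b) : a ≠ b := by
  obtain ⟨γ, hγ, -, rfl, rfl⟩ := h
  exact fun h => zero_ne_one (hγ.injective h)

theorem IsNontrivialComponent.connectedComponent_eq {S : Set X} (hS : IsNontrivialComponent S)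
    {x : X} (hx : x ∈ S) : connectedComponent x = S := by
  obtain ⟨⟨y, rfl⟩, -⟩ := hS
  exact (_root_.connectedComponent_eq hx).symm

/-- A component with exactly one free endpoint is parametrized from its other endpoint `b` to the
free one, and `b` is the only point at which it is not open. -/
theorem exists_arc_of_unique_free [T1Space X] (hstar : ConditionStar X) {S : Set X}
    (hS : IsNontrivialComponent S) (hfree : ∃! e : X, IsFreeEndpoint S e) :
    ∃ γ : unitInterval → X, IsEmbedding γ ∧ range γ = S ∧ IsOpen (S \ {γ 0}) ∧
      γ 0 ∉ interior S := by
  obtain ⟨e, ⟨⟨b, hb⟩, he⟩, huniq⟩ := hfree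
  have hbi : b ∉ interior S := fun h => hb.ne (huniq b ⟨⟨e, hb.symm⟩, h⟩).symm
  obtain ⟨a, c, hac, hopen⟩ := hstar S hS
  have hpair : ({a, c} : Set X) = {e, b} := by
    rcases hac.endpoints_eq hb with ⟨rfl, rfl⟩ | ⟨rfl, rfl⟩
    · rfl
    · exact pair_comm _ _
  rw [hpair] at hopen
  obtain ⟨γ, hγ, hr, h0, h1⟩ := hb.symm
  refine ⟨γ, hγ, hr, ?_, h0 ▸ hbi⟩
  rw [h0]
  have : S \ {b} = S \ {e, b} ∪ interior S \ {b} := by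
    ext x
    constructor
    · rintro ⟨hx, hxb⟩
      by_cases hxe : x = e
      · exact Or.inr ⟨hxe ▸ he, hxb⟩
      · exact Or.inl ⟨hx, by simpa [hxe] using hxb⟩
    · rintro (⟨hx, hxb⟩ | ⟨hx, hxb⟩)
      · exact ⟨hx, fun h => hxb (Or.inr h)⟩
      · exact ⟨interior_subset hx, hxb⟩
  rw [this]
  exact hopen.union (isOpen_interior.sdiff isClosed_singleton)

end Arcs

/-! ### The universal model and its identification with `X` -/

section Model

open Classical in
/-- The length of the segment attached to the point `s` of the Cantor space: positive exactly at
the eventually `false` sequences. -/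
noncomputable def hairLength (s : ℕ → Bool) : ℝ :=
  if h : ∃ n, ∀ k ≥ n, s k = false then (1 / 3) ^ Nat.find h / 4 else 0

theorem hairLength_nonneg (s : ℕ → Bool) : 0 ≤ hairLength s := by
  classical
  unfold hairLength
  split_ifs <;> positivity

theorem hairLength_pos_iff {s : ℕ → Bool} : 0 < hairLength s ↔ ∃ n, ∀ k ≥ n, s k = false := by
  classical
  unfold hairLength
  split_ifs with h
  · exact ⟨fun _ => h, fun _ => by positivity⟩
  · exact ⟨fun h' => absurd h' (lt_irrefl 0), fun h' => absurd h' h⟩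

theorem hairLength_le {s : ℕ → Bool} {k : ℕ} (h : s k = true) :
    hairLength s ≤ (1 / 3) ^ (k + 1) / 4 := by
  classical
  unfold hairLength
  split_ifs with hs
  · have : k + 1 ≤ Nat.find hs := by
      by_contra! hlt
      have := Nat.find_spec hs k (by omega)
      simp [h] at this
    exact div_le_div_of_nonneg_right
      (pow_le_pow_of_le_one (by norm_num) (by norm_num) this) (by norm_num)
  · positivity

theorem finite_eventually_false (n : ℕ) : {s : ℕ → Bool | ∀ k ≥ n, s k = false}.Finite := by
  refine (finite_range fun (f : Fin n → Bool) (k : ℕ) =>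
    if h : k < n then f ⟨k, h⟩ else false).subset fun s hs => ?_
  refine ⟨fun i => s i, funext fun k => ?_⟩
  by_cases h : k < n
  · simp [h]
  · simp [h, hs k (by omega)]

/-- This finiteness is what makes the height function on `X` continuous and the tips of the hairs
interior points of their components. -/
theorem finite_le_hairLength {ε : ℝ} (hε : 0 < ε) : {s | ε ≤ hairLength s}.Finite := by
  obtain ⟨N, hN⟩ := exists_pow_lt_of_lt_one hε (show (1 / 3 : ℝ) < 1 by norm_num)
  refine (finite_eventually_false N).subset fun s hs k hk => ?_
  by_contra h
  have h1 := hairLength_le (Bool.eq_true_of_not_eq_false h)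
  have h2 : (1 / 3 : ℝ) ^ (k + 1) ≤ (1 / 3) ^ N :=
    pow_le_pow_of_le_one (by norm_num) (by norm_num) (by omega)
  have h3 : ε ≤ hairLength s := hs
  have h4 : (0 : ℝ) < (1 / 3) ^ (k + 1) := by positivity
  linarith

/-- The Cantor space with a segment attached at every eventually `false` sequence. -/
def hairyCantor : Set ((ℕ → Bool) × ℝ) := {z | 0 ≤ z.2 ∧ z.2 ≤ hairLength z.1}

/-- The hypotheses of the main theorem: `(⋆)`, density of the union of the non-trivial components,
and uniqueness of their free endpoints. -/
structure IsHairySpace (X : Type*) [TopologicalSpace X] : Prop where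
  star : ConditionStar X
  dense : Dense (⋃₀ {S : Set X | IsNontrivialComponent S})
  free : ∀ S : Set X, IsNontrivialComponent S → ∃! e : X, IsFreeEndpoint S e

variable {X : Type*} [MetricSpace X] [CompactSpace X] [Nonempty X]

/-- The address determines the component and the height determines the point on it. Both are
continuous, so compactness of `X` turns injectivity into a closed embedding. -/
theorem IsHairySpace.exists_closedEmbedding (hX : IsHairySpace X) :
    ∃ F : X → (ℕ → Bool) × ℝ, IsClosedEmbedding F ∧ range F = hairyCantor := by
  let E := {S : Set X // IsNontrivialComponent S}
  choose γ hγ hr hopen hint using fun S : E => exists_arc_of_unique_free hX.star S.2 (hX.free S S.2)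
  have hmem : ∀ S t, γ S t ∈ S.1 := fun S t => hr S ▸ mem_range_self t
  have hcc : ∀ (S : E) t, connectedComponent (γ S t) = S.1 := fun S t =>
    S.2.connectedComponent_eq (hmem S t)
  have hsub : ∀ (P : Set X) (S : E) t, IsClopen P → γ S t ∈ P → S.1 ⊆ P := fun P S t hP h =>
    hcc S t ▸ hP.connectedComponent_subset h
  have hinj : ∀ (S S' : E) t t', γ S t = γ S' t' → S = S' := fun S S' t t' h =>
    Subtype.ext (by rw [← hcc S t, ← hcc S' t', h])
  have hmeet : ∀ P : Set X, IsClopen P → P.Nonempty → ∃ S : E, S.1 ⊆ P := by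
    intro P hP hne
    obtain ⟨x, hxP, S, hS, hxS⟩ := hX.dense.inter_open_nonempty P hP.2 hne
    obtain ⟨t, rfl⟩ : x ∈ range (γ ⟨S, hS⟩) := (hr ⟨S, hS⟩).ge hxS
    exact ⟨⟨S, hS⟩, hsub P _ _ hP hxP⟩
  have hEne : Nonempty E := (hmeet univ isClopen_univ univ_nonempty).nonempty
  have hEc : Countable E := by
    have hd : ({S : Set X | IsNontrivialComponent S}).PairwiseDisjoint id := by
      intro S hS S' hS' hne
      refine disjoint_left.2 fun x hx hx' => hne ?_
      rw [← hS.connectedComponent_eq hx, ← hS'.connectedComponent_eq hx']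
    refine Set.Countable.to_subtype (hd.countable_of_nonempty_interior fun S hS => ?_)
    obtain ⟨e, he, -⟩ := hX.free S hS
    exact ⟨e, he.2⟩
  obtain ⟨f, hf⟩ := exists_surjective_nat E
  obtain ⟨U, hU⟩ := (countable_clopens X).exists_eq_range ⟨univ, isClopen_univ⟩
  obtain ⟨φ, hφc, hφs, hφ, hφp⟩ := exists_address U (fun k => hU.ge (mem_range_self k))
    (fun V hV => hU.le hV) (fun j => γ (f j) 1)
    (fun P hP hne => by
      obtain ⟨S, hS⟩ := hmeet P hP hne
      obtain ⟨j, rfl⟩ := hf S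
      exact ⟨j, hS (hmem _ _)⟩)
    (fun P hP hne hpre => by
      obtain ⟨S, hS⟩ := hmeet P hP hne
      have : P = S.1 := by
        refine Subset.antisymm ?_ hS
        rw [← hcc S 0]
        exact hpre.subset_connectedComponent (hS (hmem S 0))
      refine hint S ?_
      rw [← this, hP.2.interior_eq]
      exact hS (hmem S 0))
    (fun i j h => by
      rw [hcc, hcc] at h
      rw [Subtype.ext h])
  have hφ' : ∀ S t t', φ (γ S t) = φ (γ S t') := fun S t t' => (hφ _ _).2 (by rw [hcc, hcc])
  have hpos : ∀ x, 0 < hairLength (φ x) ↔ ∃ S t, γ S t = x := by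
    intro x
    rw [hairLength_pos_iff, hφp]
    constructor
    · rintro ⟨j, hj⟩
      rw [hφ, hcc] at hj
      obtain ⟨t, ht⟩ : x ∈ range (γ (f j)) := by
        rw [hr, hj]
        exact mem_connectedComponent
      exact ⟨_, t, ht⟩
    · rintro ⟨S, t, rfl⟩
      obtain ⟨j, rfl⟩ := hf S
      exact ⟨j, hφ' _ _ _⟩
  have hex : ∀ x, ∃ r : ℝ, (∀ S t, γ S t = x → r = hairLength (φ x) * t) ∧
      ((¬ ∃ S t, γ S t = x) → r = 0) := by
    intro x
    by_cases h : ∃ S t, γ S t = x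
    · obtain ⟨S, t, rfl⟩ := h
      refine ⟨hairLength (φ (γ S t)) * t, fun S' t' h' => ?_, fun h => absurd ⟨S, t, rfl⟩ h⟩
      obtain rfl := hinj _ _ _ _ h'
      rw [(hγ S').injective h']
    · exact ⟨0, fun S t h' => absurd ⟨S, t, h'⟩ h, fun _ => rfl⟩
  choose h hh hh0 using hex
  have hnonneg : ∀ x, 0 ≤ h x := by
    intro x
    by_cases hx : ∃ S t, γ S t = x
    · obtain ⟨S, t, ht⟩ := hx
      rw [hh x S t ht]
      exact mul_nonneg (hairLength_nonneg _) t.2.1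
    · exact (hh0 x hx).ge
  have hle : ∀ x, h x ≤ hairLength (φ x) := by
    intro x
    by_cases hx : ∃ S t, γ S t = x
    · obtain ⟨S, t, ht⟩ := hx
      rw [hh x S t ht]
      exact mul_le_of_le_one_right (hairLength_nonneg _) t.2.2
    · exact (hh0 x hx).trans_le (hairLength_nonneg _)
  have harc : ∀ x, 0 < h x → ∃ S t, γ S t = x := fun x hx => (hpos x).1 (hx.trans_le (hle x))
  have hc : Continuous h := by
    refine OrderTopology.continuous_iff.2 fun ε => ⟨?_, ?_⟩
    · rcases lt_or_ge ε 0 with hε | hε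
      · convert isOpen_univ
        exact eq_univ_of_forall fun x => hε.trans_le (hnonneg x)
      -- Each arc without its non-free endpoint is open, and what is removed from it is compact.
      · have : h ⁻¹' Ioi ε = ⋃ S : E, (S.1 \ {γ S 0}) \
            γ S '' {t | hairLength (φ (γ S 0)) * t ≤ ε} := by
          ext x
          simp only [mem_preimage, mem_Ioi, mem_iUnion]
          constructor
          · intro hx
            obtain ⟨S, t, rfl⟩ := harc x (hε.trans_lt hx)
            rw [hh _ S t rfl] at hx
            refine ⟨S, ⟨hmem S t, fun h0 => ?_⟩, ?_⟩
            · rw [(hγ S).injective h0] at hx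
              simp at hx
              exact hx.not_ge hε
            · rintro ⟨t', ht', h'⟩
              rw [(hγ S).injective h', mem_ofPred_eq, hφ' S 0 t] at ht'
              exact hx.not_ge ht'
          · rintro ⟨S, ⟨hxS, -⟩, hx⟩
            rw [← hr S] at hxS
            obtain ⟨t, rfl⟩ := hxS
            rw [hh _ S t rfl]
            by_contra! hlt
            exact hx ⟨t, by rwa [mem_ofPred_eq, hφ' S 0 t], rfl⟩
        rw [this]
        refine isOpen_iUnion fun S => (hopen S).sdiff ?_
        refine (IsCompact.image ?_ (hγ S).continuous).isClosed
        exact (isClosed_le (by fun_prop) continuous_const).isCompact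
    · rw [← isClosed_compl_iff, ← preimage_compl, compl_Iio]
      rcases le_or_gt ε 0 with hε | hε
      · convert isClosed_univ
        exact eq_univ_of_forall fun x => hε.trans (hnonneg x)
      -- Only finitely many arcs reach height `ε`, and each contributes a compact subarc.
      · have : h ⁻¹' Ici ε = ⋃ S ∈ {S : E | ε ≤ hairLength (φ (γ S 0))},
            γ S '' {t | ε ≤ hairLength (φ (γ S 0)) * t} := by
          ext x
          simp only [mem_preimage, mem_Ici, mem_iUnion]
          constructor
          · intro hx
            obtain ⟨S, t, rfl⟩ := harc x (hε.trans_le hx)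
            refine ⟨S, ?_, t, ?_, rfl⟩
            · rw [mem_ofPred_eq, hφ' S 0 t]
              exact hx.trans (hle _)
            · rwa [mem_ofPred_eq, hφ' S 0 t, ← hh _ S t rfl]
          · rintro ⟨S, -, t, ht, rfl⟩
            rwa [hh _ S t rfl, hφ' S t 0]
        rw [this]
        refine Set.Finite.isClosed_biUnion ?_ fun S _ => ?_
        · refine (finite_le_hairLength hε).preimage (f := fun S : E => φ (γ S 0)) ?_
          intro S _ S' _ hSS
          have := (hφ _ _).1 hSS
          rw [hcc, hcc] at this
          exact Subtype.ext this
        · refine (IsCompact.image ?_ (hγ S).continuous).isClosed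
          exact (isClosed_le continuous_const (by fun_prop)).isCompact
  refine ⟨fun x => (φ x, h x), (hφc.prodMk hc).isClosedEmbedding ?_, ?_⟩
  · intro x y hxy
    obtain ⟨h1, h2⟩ := Prod.mk.inj hxy
    by_cases hx : ∃ S t, γ S t = x
    · obtain ⟨S, t, rfl⟩ := hx
      have hp : 0 < hairLength (φ (γ S t)) := (hpos _).2 ⟨S, t, rfl⟩
      obtain ⟨S', t', rfl⟩ := (hpos y).1 (h1 ▸ hp)
      have hS := (hφ _ _).1 h1
      rw [hcc, hcc] at hS
      obtain rfl := Subtype.ext hS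
      rw [hh _ S t rfl, hh _ S t' rfl, ← h1] at h2
      rw [Subtype.ext (mul_left_cancel₀ hp.ne' h2)]
    -- Two distinct points with one address make their component non-trivial, so `x` would lie on an
    -- arc after all.
    · by_contra hne
      have hS : IsNontrivialComponent (connectedComponent x) := by
        refine ⟨⟨x, rfl⟩, x, mem_connectedComponent, y, ?_, hne⟩
        rw [(hφ x y).1 h1]
        exact mem_connectedComponent
      have hxr : x ∈ range (γ ⟨_, hS⟩) := by
        rw [hr]
        exact mem_connectedComponent
      obtain ⟨t, ht⟩ := hxr
      exact hx ⟨_, t, ht⟩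
  · refine Subset.antisymm ?_ ?_
    · rintro _ ⟨x, rfl⟩
      exact ⟨hnonneg x, hle x⟩
    · rintro ⟨s, r⟩ ⟨hr0, hr1⟩
      obtain ⟨x, rfl⟩ := hφs s
      simp only at hr0 hr1
      by_cases hx : 0 < hairLength (φ x)
      · obtain ⟨S, t, rfl⟩ := (hpos x).1 hx
        refine ⟨γ S ⟨r / hairLength (φ (γ S t)), by positivity, (div_le_one hx).2 hr1⟩, ?_⟩
        refine Prod.ext (hφ' _ _ _) ?_
        change h _ = r
        rw [hh _ S _ rfl, hφ' S _ t]
        exact mul_div_cancel₀ _ hx.ne'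
      · have h0 := (hairLength_nonneg (φ x)).antisymm' (not_lt.1 hx)
        refine ⟨x, Prod.ext rfl ?_⟩
        have := hnonneg x
        have := hle x
        change h x = r
        linarith

theorem IsHairySpace.nonempty_homeomorph_hairyCantor (hX : IsHairySpace X) :
    Nonempty (X ≃ₜ hairyCantor) := by
  obtain ⟨F, hF, hr⟩ := hX.exists_closedEmbedding
  exact ⟨hF.isEmbedding.toHomeomorph.trans (Homeomorph.setCongr hr)⟩

/-- Compactness of the model is inherited from `X`; the existence part takes it as a hypothesis. -/
theorem IsHairySpace.isCompact_hairyCantor (hX : IsHairySpace X) : IsCompact hairyCantor := by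
  obtain ⟨F, hF, hr⟩ := hX.exists_closedEmbedding
  exact hr ▸ isCompact_range hF.continuous

end Model

/-! ### Special L-Cantorvals satisfy the hypotheses -/

section RealLine

variable {K : Set ℝ}

theorem exists_right_end (hK : IsClosed K) {x k : ℝ} (hx : x ∉ K) (hk : k ∈ K) (hxk : x < k) :
    ∃ b ∈ K, x < b ∧ b ≤ k ∧ Ico x b ⊆ Kᶜ ∧ IsLUB (connectedComponentIn Kᶜ x) b := by
  have hne : (K ∩ Ici x).Nonempty := ⟨k, hk, hxk.le⟩
  have hbdd : BddBelow (K ∩ Ici x) := ⟨x, fun y hy => hy.2⟩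
  have hmem := (hK.inter isClosed_Ici).csInf_mem hne hbdd
  set b := sInf (K ∩ Ici x)
  have hxb : x < b := lt_of_le_of_ne hmem.2 fun h => hx (h ▸ hmem.1)
  have hIco : Ico x b ⊆ Kᶜ := fun y hy hyK => hy.2.not_ge (csInf_le hbdd ⟨hyK, hy.1⟩)
  refine ⟨b, hmem.1, hxb, csInf_le hbdd ⟨hk, hxk.le⟩, hIco, ?_, ?_⟩
  · intro y hy
    by_contra! hby
    exact connectedComponentIn_subset _ _ (isPreconnected_connectedComponentIn.ordConnected.out
      (mem_connectedComponentIn hx) hy ⟨hxb.le, hby.le⟩) hmem.1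
  · intro u hu
    by_contra! hub
    have hsub := isPreconnected_Ico.subset_connectedComponentIn (left_mem_Ico.2 hxb) hIco
    have hxu : x ≤ u := hu (mem_connectedComponentIn hx)
    have := hu (hsub (show (u + b) / 2 ∈ Ico x b from ⟨by linarith, by linarith⟩))
    linarith

theorem exists_left_end (hK : IsClosed K) {x k : ℝ} (hx : x ∉ K) (hk : k ∈ K) (hkx : k < x) :
    ∃ a ∈ K, a < x ∧ k ≤ a ∧ Ioc a x ⊆ Kᶜ ∧ IsGLB (connectedComponentIn Kᶜ x) a := by
  have hne : (K ∩ Iic x).Nonempty := ⟨k, hk, hkx.le⟩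
  have hbdd : BddAbove (K ∩ Iic x) := ⟨x, fun y hy => hy.2⟩
  have hmem := (hK.inter isClosed_Iic).csSup_mem hne hbdd
  set a := sSup (K ∩ Iic x)
  have hax : a < x := lt_of_le_of_ne hmem.2 fun h => hx (h ▸ hmem.1)
  have hIoc : Ioc a x ⊆ Kᶜ := fun y hy hyK => hy.1.not_ge (le_csSup hbdd ⟨hyK, hy.2⟩)
  refine ⟨a, hmem.1, hax, le_csSup hbdd ⟨hk, hkx.le⟩, hIoc, ?_, ?_⟩
  · intro y hy
    by_contra! hya
    exact connectedComponentIn_subset _ _ (isPreconnected_connectedComponentIn.ordConnected.out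
      hy (mem_connectedComponentIn hx) ⟨hya.le, hax.le⟩) hmem.1
  · intro u hu
    by_contra! hub
    have hsub := isPreconnected_Ioc.subset_connectedComponentIn (right_mem_Ioc.2 hax) hIoc
    have hxu : u ≤ x := hu (mem_connectedComponentIn hx)
    have := hu (hsub (show (a + u) / 2 ∈ Ioc a x from ⟨by linarith, by linarith⟩))
    linarith

theorem IsNontrivialComponent.isInterval {S : Set K} (hS : IsNontrivialComponent S) :
    IsInterval K (Subtype.val '' S) := by
  obtain ⟨⟨x, rfl⟩, hne⟩ := hS
  exact ⟨⟨x, x.2, by rw [connectedComponentIn_eq_image x.2]⟩, hne.image Subtype.val_injective⟩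

theorem IsInterval.exists_component {J : Set ℝ} (hJ : IsInterval K J) :
    ∃ S : Set K, IsNontrivialComponent S ∧ Subtype.val '' S = J := by
  obtain ⟨⟨x, hx, rfl⟩, hne⟩ := hJ
  rw [connectedComponentIn_eq_image hx] at hne ⊢
  exact ⟨_, ⟨⟨_, rfl⟩, Set.nontrivial_of_image _ _ hne⟩, rfl⟩

theorem IsInterval.eq_of_mem {J J' : Set ℝ} (hJ : IsInterval K J) (hJ' : IsInterval K J') {x : ℝ}
    (hx : x ∈ J) (hx' : x ∈ J') : J = J' := by
  obtain ⟨⟨y, -, rfl⟩, -⟩ := hJ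
  obtain ⟨⟨z, -, rfl⟩, -⟩ := hJ'
  exact (connectedComponentIn_eq hx).trans (connectedComponentIn_eq hx').symm

theorem IsInterval.eq_Icc (hK : IsCompact K) {J : Set ℝ} (hJ : IsInterval K J) :
    ∃ p q, p < q ∧ J = Icc p q := by
  obtain ⟨⟨x, hx, rfl⟩, hne⟩ := id hJ
  have := isCompact_iff_compactSpace.1 hK
  have hc : IsCompact (connectedComponentIn K x) := by
    rw [connectedComponentIn_eq_image hx]
    exact isClosed_connectedComponent.isCompact.image continuous_subtype_val
  have heq := eq_Icc_of_connected_compact (isConnected_connectedComponentIn_iff.2 hx) hc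
  refine ⟨_, _, ?_, heq⟩
  rw [heq] at hne
  by_contra! h
  exact hne.not_subsingleton (subsingleton_Icc_of_ge h)

theorem isArc_of_image_eq_Icc {S : Set K} {p q : K} (hpq : (p : ℝ) < q)
    (hS : Subtype.val '' S = Icc (p : ℝ) q) : IsArc S p q := by
  have hsub : Icc (p : ℝ) q ⊆ K := hS ▸ Subtype.coe_image_subset K S
  refine ⟨inclusion hsub ∘ (iccHomeoI (p : ℝ) q hpq).symm,
    (IsEmbedding.inclusion hsub).comp (iccHomeoI (p : ℝ) q hpq).symm.isEmbedding, ?_, ?_, ?_⟩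
  · rw [(iccHomeoI (p : ℝ) q hpq).symm.surjective.range_comp, range_inclusion, ← hS]
    exact preimage_image_eq _ Subtype.val_injective
  · exact Subtype.ext (by simp)
  · exact Subtype.ext (by simp)

theorem IsNontrivialComponent.exists_Icc (hK : IsCompact K) {S : Set K}
    (hS : IsNontrivialComponent S) :
    ∃ p q : K, (p : ℝ) < q ∧ Subtype.val '' S = Icc (p : ℝ) q := by
  obtain ⟨p, q, hpq, h⟩ := hS.isInterval.eq_Icc hK
  have hsub : Icc p q ⊆ K := h ▸ Subtype.coe_image_subset K S
  exact ⟨⟨p, hsub (left_mem_Icc.2 hpq.le)⟩, ⟨q, hsub (right_mem_Icc.2 hpq.le)⟩, hpq, h⟩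

theorem conditionStar_of_isCompact (hK : IsCompact K) : ConditionStar K := by
  intro S hS
  obtain ⟨p, q, hpq, h⟩ := hS.exists_Icc hK
  refine ⟨p, q, isArc_of_image_eq_Icc hpq h, ?_⟩
  have : S \ {p, q} = Subtype.val ⁻¹' Ioo (p : ℝ) q := by
    rw [← Icc_sdiff_both, ← h, preimage_sdiff, preimage_image_eq _ Subtype.val_injective]
    ext x
    simp [Subtype.ext_iff]
  rw [this]
  exact isOpen_Ioo.preimage continuous_subtype_val

/-- If `q` were interior, a gap would start at `q`. The condition at its left end, with `ε = q - p`,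
would place a whole `K`-interval inside `(p, q)`; but that interval would have to be the component
`[p, q]` itself. -/
theorem IsLCantorval.right_end_notMem_interior (hK : IsLCantorval K) {S : Set K}
    (hS : IsNontrivialComponent S) {p q : K} (hpq : (p : ℝ) < q)
    (h : Subtype.val '' S = Icc (p : ℝ) q) : q ∉ interior S := by
  intro hq
  obtain ⟨ε, hε, hball⟩ := Metric.mem_nhds_iff.1 (mem_interior_iff_mem_nhds.1 hq)
  have hle : ∀ y : K, dist y q < ε → (y : ℝ) ≤ q := fun y hy =>
    (h.le (mem_image_of_mem _ (hball hy))).2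
  have hx : (q : ℝ) + ε / 2 ∉ K := by
    intro hx
    have := hle ⟨_, hx⟩ (by simp [Subtype.dist_eq, abs_of_pos hε, hε])
    simp only at this
    linarith
  obtain ⟨a, haK, hax, hqa, -, hglb⟩ := exists_left_end hK.isCompact.isClosed hx q.2 (by linarith)
  have haq : a = q := by
    refine le_antisymm (hle ⟨a, haK⟩ ?_) hqa
    rw [Subtype.dist_eq, Real.dist_eq, abs_of_nonneg (by simpa using hqa)]
    simp only
    linarith
  subst haq
  obtain ⟨J, hJ, hJs⟩ := (hK.left _ ⟨_, hx, rfl⟩ _ hglb (q - p) (by linarith)).1.nonempty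
  rw [sub_sub_cancel] at hJs
  obtain ⟨y, hy⟩ := hJ.2.nonempty
  have := hJ.eq_of_mem hS.isInterval hy (h ▸ Ioo_subset_Icc_self (hJs hy))
  have hqJ : (q : ℝ) ∈ J := by
    rw [this, h]
    exact right_mem_Icc.2 hpq.le
  exact lt_irrefl _ (hJs hqJ).2

/-- A point with trivial component has points outside `K` arbitrarily close on its left, and a
`K`-interval starts at the right end of each such gap. -/
theorem IsLCantorval.dense_components (hK : IsLCantorval K) :
    Dense (⋃₀ {S : Set K | IsNontrivialComponent S}) := by
  refine Metric.dense_iff.2 fun x ε hε => ?_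
  by_cases hx : (connectedComponent x).Nontrivial
  · exact ⟨x, Metric.mem_ball_self hε, _, ⟨⟨x, rfl⟩, hx⟩, mem_connectedComponent⟩
  obtain ⟨y, hy1, hy2, hyK⟩ : ∃ y, (x : ℝ) - ε < y ∧ y < x ∧ y ∉ K := by
    by_contra! hall
    have hsub : Icc ((x : ℝ) - ε / 2) x ⊆ K := by
      intro y hy
      rcases hy.2.lt_or_eq with h | h
      · exact hall y (by linarith [hy.1]) h
      · exact h ▸ x.2
    have hle : (x : ℝ) - ε / 2 ≤ x := by linarith
    have hcc := isPreconnected_Icc.subset_connectedComponentIn (right_mem_Icc.2 hle) hsub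
    rw [connectedComponentIn_eq_image x.2] at hcc
    refine hx (Set.nontrivial_of_image Subtype.val _ ⟨_, hcc (left_mem_Icc.2 hle), _,
      hcc (right_mem_Icc.2 hle), by linarith⟩)
  obtain ⟨b, hbK, hyb, hbx, -, hlub⟩ := exists_right_end hK.isCompact.isClosed hyK x.2 hy2
  obtain ⟨J, hJ, hb⟩ := hK.right _ ⟨y, hyK, rfl⟩ b hlub
  obtain ⟨S, hS, rfl⟩ := hJ.exists_component
  obtain ⟨b', hb', rfl⟩ := hb.1
  refine ⟨b', ?_, S, hS, hb'⟩
  rw [Metric.mem_ball, Subtype.dist_eq, Real.dist_eq, abs_lt]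
  constructor <;> linarith

theorem IsSpecialLCantorval.isHairySpace (hK : IsSpecialLCantorval K) : IsHairySpace K := by
  refine ⟨conditionStar_of_isCompact hK.isCompact, hK.dense_components, fun S hS => ?_⟩
  obtain ⟨a, ha, hfree⟩ := hK.left_free _ hS.isInterval
  rw [preimage_image_eq _ Subtype.val_injective] at hfree
  obtain ⟨p, q, hpq, h⟩ := hS.exists_Icc hK.isCompact
  have hap : a = p := Subtype.ext (ha.unique (h ▸ isLeast_Icc hpq.le))
  refine ⟨a, hfree, fun e he => ?_⟩
  obtain ⟨⟨b, hb⟩, hint⟩ := he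
  rcases hb.endpoints_eq (isArc_of_image_eq_Icc hpq h) with ⟨rfl, -⟩ | ⟨rfl, -⟩
  · exact hap.symm
  · exact absurd hint (hK.right_end_notMem_interior hS hpq h)

end RealLine

/-! ### Laying out the model as a special L-Cantorval -/

section Existence

open Cardinal Filter

theorem cantorFunction_third_nonneg (s : ℕ → Bool) : 0 ≤ cantorFunction (1 / 3) s :=
  tsum_nonneg fun _ => cantorFunctionAux_nonneg (by norm_num)

theorem cantorFunction_third_le (s : ℕ → Bool) : cantorFunction (1 / 3) s ≤ 3 / 2 := by
  refine (cantorFunction_le (g := fun _ => true) (by norm_num) (by norm_num) (by simp)).trans ?_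
  have : cantorFunction (1 / 3) (fun _ => true) = ∑' n : ℕ, (1 / 3 : ℝ) ^ n :=
    tsum_congr fun n => cantorFunctionAux_true rfl
  rw [this, tsum_geometric_of_lt_one (by norm_num) (by norm_num)]
  norm_num

/-- The digit `n` contributes `3⁻ⁿ`, while all later digits together contribute at most `3⁻ⁿ / 2`.
-/
theorem cantorFunction_third_add_le {n : ℕ} {s t : ℕ → Bool} (hn : ∀ k < n, s k = t k)
    (hs : s n = false) (ht : t n = true) :
    cantorFunction (1 / 3) s + (1 / 3) ^ n / 2 ≤ cantorFunction (1 / 3) t := by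
  induction n generalizing s t with
  | zero =>
    rw [cantorFunction_succ s (by norm_num) (by norm_num),
      cantorFunction_succ t (by norm_num) (by norm_num), hs, ht]
    have h1 := cantorFunction_third_le fun n => s (n + 1)
    have h2 := cantorFunction_third_nonneg fun n => t (n + 1)
    simp only [cond_true, cond_false, pow_zero]
    linarith
  | succ n ih =>
    rw [cantorFunction_succ s (by norm_num) (by norm_num),
      cantorFunction_succ t (by norm_num) (by norm_num), hn 0 n.succ_pos, pow_succ']
    have := ih (s := fun n => s (n + 1)) (t := fun n => t (n + 1))
      (fun k hk => hn _ (Nat.succ_lt_succ hk)) hs ht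
    linarith

theorem continuous_cantorFunction_third : Continuous (cantorFunction (1 / 3)) := by
  refine continuous_tsum (u := fun n => (1 / 3 : ℝ) ^ n) (fun n => ?_)
    (summable_geometric_of_lt_one (by norm_num) (by norm_num)) fun n s => ?_
  · exact (continuous_of_discreteTopology (f := fun b : Bool => cond b ((1 / 3 : ℝ) ^ n) 0)).comp
      (continuous_apply n)
  · rw [Real.norm_of_nonneg (cantorFunctionAux_nonneg (by norm_num))]
    cases h : s n <;> simp [h]

/-- The map laying out `hairyCantor` on the real line, every segment to the left of its base. -/
noncomputable def layout (z : (ℕ → Bool) × ℝ) : ℝ := cantorFunction (1 / 3) z.1 - z.2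

theorem continuous_layout : Continuous layout :=
  (continuous_cantorFunction_third.comp continuous_fst).sub continuous_snd

/-- The bases are at least `3⁻ⁿ / 2` apart, and since `z` has digit `true` at `n` its hair has
length at most `3⁻ⁿ / 12`, so it cannot reach back to `y`. -/
theorem layout_lt_layout {y z : (ℕ → Bool) × ℝ} (hy : y ∈ hairyCantor) (hz : z ∈ hairyCantor)
    {n : ℕ} (hn : ∀ k < n, y.1 k = z.1 k) (h1 : y.1 n = false) (h2 : z.1 n = true) :
    layout y < layout z := by
  have h3 := cantorFunction_third_add_le hn h1 h2
  have h4 := hairLength_le h2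
  have h5 := hy.1
  have h6 := hz.2
  have h7 : (0 : ℝ) < (1 / 3) ^ n := by positivity
  rw [pow_succ] at h4
  unfold layout
  linarith

theorem injOn_layout : InjOn layout hairyCantor := by
  intro y hy z hz h
  have h1 : y.1 = z.1 := by
    by_contra hne
    have hd := PiNat.apply_firstDiff_ne hne
    have hlt : ∀ k < PiNat.firstDiff y.1 z.1, y.1 k = z.1 k := fun k hk =>
      PiNat.apply_eq_of_lt_firstDiff hk
    cases hy' : y.1 (PiNat.firstDiff y.1 z.1) <;> cases hz' : z.1 (PiNat.firstDiff y.1 z.1)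
    · exact hd (hy'.trans hz'.symm)
    · exact (layout_lt_layout hy hz hlt hy' hz').ne h
    · exact (layout_lt_layout hz hy (fun k hk => (hlt k hk).symm) hz' hy').ne h.symm
    · exact hd (hy'.trans hz'.symm)
  refine Prod.ext h1 ?_
  unfold layout at h
  rw [h1] at h
  linarith

/-- The set of reals obtained by laying out `hairyCantor`. -/
def cantorval : Set ℝ := layout '' hairyCantor

theorem layout_mem_cantorval {s : ℕ → Bool} {t : ℝ} (h0 : 0 ≤ t) (h1 : t ≤ hairLength s) :
    cantorFunction (1 / 3) s - t ∈ cantorval := ⟨(s, t), ⟨h0, h1⟩, rfl⟩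

theorem cantorFunction_mem_cantorval (s : ℕ → Bool) : cantorFunction (1 / 3) s ∈ cantorval := by
  simpa using layout_mem_cantorval le_rfl (hairLength_nonneg s)

/-- The component of `cantorval` over the point `s` of the Cantor space. -/
noncomputable def hair (s : ℕ → Bool) : Set ℝ :=
  Icc (cantorFunction (1 / 3) s - hairLength s) (cantorFunction (1 / 3) s)

theorem hair_subset_cantorval (s : ℕ → Bool) : hair s ⊆ cantorval := by
  intro x hx
  have := layout_mem_cantorval (s := s) (t := cantorFunction (1 / 3) s - x)
    (by linarith [hx.2]) (by linarith [hx.1])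
  rwa [sub_sub_cancel] at this

theorem exists_mem_hair {x : ℝ} (hx : x ∈ cantorval) : ∃ s, x ∈ hair s := by
  obtain ⟨⟨s, t⟩, ⟨h0, h1⟩, rfl⟩ := hx
  simp only at h0 h1
  exact ⟨s, by simp only [layout]; linarith, by simp only [layout]; linarith⟩

theorem exists_homeomorph_cantorval (hc : IsCompact hairyCantor) :
    ∃ e : hairyCantor ≃ₜ cantorval, ∀ z, (e z : ℝ) = layout z := by
  have := isCompact_iff_compactSpace.1 hc
  have hemb : IsClosedEmbedding (hairyCantor.domRestrict layout) :=
    (continuous_layout.comp continuous_subtype_val).isClosedEmbedding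
      (injOn_iff_injective.1 injOn_layout)
  exact ⟨hemb.isEmbedding.toHomeomorph.trans (Homeomorph.setCongr (range_domRestrict _ _)),
    fun z => rfl⟩

/-- The base point in the Cantor space depends continuously on the point of `cantorval`, hence is
constant on connected sets. -/
theorem connectedComponentIn_cantorval (hc : IsCompact hairyCantor) {s : ℕ → Bool} {x : ℝ}
    (hx : x ∈ hair s) : connectedComponentIn cantorval x = hair s := by
  refine Subset.antisymm ?_ (isPreconnected_Icc.subset_connectedComponentIn hx
    (hair_subset_cantorval s))
  obtain ⟨e, he⟩ := exists_homeomorph_cantorval hc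
  have hxK := hair_subset_cantorval s hx
  rw [connectedComponentIn_eq_image hxK]
  rintro _ ⟨y, hy, rfl⟩
  have hs : (e.symm ⟨x, hxK⟩).1.1 = s := by
    have : e ⟨(s, cantorFunction (1 / 3) s - x),
        by linarith [hx.2], by linarith [hx.1]⟩ = ⟨x, hxK⟩ :=
      Subtype.ext (by rw [he]; simp [layout])
    rw [← this, e.symm_apply_apply]
  have hcont : Continuous fun y => (e.symm y).1.1 :=
    continuous_fst.comp (continuous_subtype_val.comp e.symm.continuous)
  have hys : (e.symm y).1.1 = s := by
    rw [← hs]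
    exact (isPreconnected_connectedComponent.image _ hcont.continuousOn).subsingleton
      (mem_image_of_mem _ hy) (mem_image_of_mem _ mem_connectedComponent)
  have hey := he (e.symm y)
  rw [e.apply_symm_apply, layout, hys] at hey
  obtain ⟨h0, h1⟩ := (e.symm y).2
  rw [hys] at h1
  rw [hey]
  constructor <;> linarith

theorem isInterval_hair (hc : IsCompact hairyCantor) {s : ℕ → Bool} (hs : 0 < hairLength s) :
    IsInterval cantorval (hair s) := by
  have hmem : cantorFunction (1 / 3) s ∈ hair s := ⟨by linarith, le_rfl⟩
  refine ⟨⟨_, hair_subset_cantorval s hmem, connectedComponentIn_cantorval hc hmem⟩, ?_⟩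
  exact ⟨_, left_mem_Icc.2 (by linarith), _, hmem, by linarith⟩

theorem IsInterval.exists_hair (hc : IsCompact hairyCantor) {J : Set ℝ}
    (hJ : IsInterval cantorval J) : ∃ s, 0 < hairLength s ∧ J = hair s := by
  obtain ⟨⟨x, hx, rfl⟩, hne⟩ := hJ
  obtain ⟨s, hs⟩ := exists_mem_hair hx
  rw [connectedComponentIn_cantorval hc hs] at hne ⊢
  refine ⟨s, ?_, rfl⟩
  by_contra! h
  exact hne.not_subsingleton (subsingleton_Icc_of_ge (by linarith))

/-- Points near the tip have height above half the hair's length. Only finitely many other hairs are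
that long, and their bases stay away from `s`. -/
theorem hair_mem_nhds (hc : IsCompact hairyCantor) {s : ℕ → Bool} (hs : 0 < hairLength s)
    (h : cantorFunction (1 / 3) s - hairLength s ∈ cantorval) :
    (Subtype.val ⁻¹' hair s : Set cantorval) ∈ 𝓝 ⟨_, h⟩ := by
  obtain ⟨e, he⟩ := exists_homeomorph_cantorval hc
  let z : hairyCantor := ⟨(s, hairLength s), hs.le, le_rfl⟩
  have hez : e z = ⟨_, h⟩ := Subtype.ext (he z)
  rw [← hez, ← e.map_nhds_eq, mem_map]
  have hfin := (finite_le_hairLength (half_pos hs)).subset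
    (show {u | hairLength s / 2 ≤ hairLength u} \ {s} ⊆ _ from sdiff_subset)
  have h1 : ∀ᶠ y : hairyCantor in 𝓝 z,
      y.1.1 ∉ {u | hairLength s / 2 ≤ hairLength u} \ {s} :=
    ((continuous_fst.comp continuous_subtype_val).tendsto z).eventually
      (hfin.isClosed.isOpen_compl.mem_nhds fun h => h.2 rfl)
  have h2 : ∀ᶠ y : hairyCantor in 𝓝 z, hairLength s / 2 < y.1.2 :=
    (continuous_snd.comp continuous_subtype_val).continuousAt.eventually
      (lt_mem_nhds (half_lt_self hs))
  filter_upwards [h1, h2] with y hy1 hy2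
  obtain ⟨h0, hle⟩ := y.2
  have hys : y.1.1 = s := by
    by_contra hne
    exact hy1 ⟨(hy2.trans_le hle).le, hne⟩
  rw [hys] at hle
  rw [mem_preimage, mem_preimage, he, layout, hys]
  constructor <;> linarith

/-- To the left of a non-trivial component of `cantorval` there are points outside `cantorval`. -/
theorem exists_notMem_left_of_hair (hc : IsCompact hairyCantor) {s : ℕ → Bool}
    (hs : 0 < hairLength s) {u : ℝ} (hu : u < cantorFunction (1 / 3) s - hairLength s) :
    ∃ y ∉ cantorval, u < y ∧ y < cantorFunction (1 / 3) s - hairLength s := by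
  have h := layout_mem_cantorval hs.le le_rfl
  obtain ⟨ε, hε, hball⟩ := Metric.mem_nhds_iff.1 (hair_mem_nhds hc hs h)
  obtain ⟨y, hy1, hy2⟩ := exists_between (max_lt hu (sub_lt_self _ hε))
  rw [max_lt_iff] at hy1
  refine ⟨y, fun hy => ?_, hy1.1, hy2⟩
  have : (⟨y, hy⟩ : cantorval) ∈ Metric.ball ⟨_, h⟩ ε := by
    rw [Metric.mem_ball, Subtype.dist_eq, Real.dist_eq, abs_lt]
    constructor <;> simp only <;> linarith
  exact hy2.not_ge (hball this).1

/-- The sequence agreeing with `s` before `n` and constantly `b` from `n` on. -/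
def tail (b : Bool) (s : ℕ → Bool) (n k : ℕ) : Bool := if k < n then s k else b

theorem tendsto_tail (b : Bool) (s : ℕ → Bool) : Tendsto (tail b s) atTop (𝓝 s) := by
  refine tendsto_pi_nhds.2 fun k => tendsto_const_nhds.congr' ?_
  filter_upwards [eventually_gt_atTop k] with n hn
  simp [tail, hn]

theorem tail_ne {b : Bool} {s : ℕ → Bool} (hs : ¬ ∃ n, ∀ k ≥ n, s k = b) (n : ℕ) :
    tail b s n ≠ s := fun h => hs ⟨n, fun k hk => by rw [← h]; simp [tail, hk.not_gt]⟩

theorem tendsto_cantorFunction_tail (b : Bool) (s : ℕ → Bool) :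
    Tendsto (fun n => cantorFunction (1 / 3) (tail b s n)) atTop (𝓝 (cantorFunction (1 / 3) s)) :=
  (continuous_cantorFunction_third.tendsto s).comp (tendsto_tail b s)

theorem cantorFunction_tail_false_lt {s : ℕ → Bool} (hs : ¬ ∃ n, ∀ k ≥ n, s k = false) (n : ℕ) :
    cantorFunction (1 / 3) (tail false s n) < cantorFunction (1 / 3) s := by
  refine lt_of_le_of_ne (cantorFunction_le (by norm_num) (by norm_num) fun k => ?_) fun h =>
    tail_ne hs n (cantorFunction_injective (by norm_num) (by norm_num) h)
  by_cases hk : k < n <;> simp [tail, hk]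

theorem lt_cantorFunction_tail_true {s : ℕ → Bool} (hs : ¬ ∃ n, ∀ k ≥ n, s k = true) (n : ℕ) :
    cantorFunction (1 / 3) s < cantorFunction (1 / 3) (tail true s n) := by
  refine lt_of_le_of_ne (cantorFunction_le (by norm_num) (by norm_num) fun k => ?_) fun h =>
    tail_ne hs n (cantorFunction_injective (by norm_num) (by norm_num) h.symm)
  by_cases hk : k < n <;> simp [tail, hk]

theorem hairLength_tail_false_pos (s : ℕ → Bool) (n : ℕ) : 0 < hairLength (tail false s n) :=
  hairLength_pos_iff.2 ⟨n, fun k hk => by simp [tail, hk.not_gt]⟩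

/-- The truncations of `s` carry hairs, their bases approach that of `s` strictly from the left, and
their lengths become small since only finitely many hairs are long. -/
theorem exists_hair_subset_Ioo {s : ℕ → Bool} (hs : ¬ ∃ n, ∀ k ≥ n, s k = false) {ε : ℝ}
    (hε : 0 < ε) : ∃ u, 0 < hairLength u ∧
      hair u ⊆ Ioo (cantorFunction (1 / 3) s - ε) (cantorFunction (1 / 3) s) := by
  have hfin := (finite_le_hairLength (half_pos hε)).subset
    (show {u | ε / 2 ≤ hairLength u} \ {s} ⊆ _ from sdiff_subset)
  have h1 := (tendsto_tail false s).eventually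
    (hfin.isClosed.isOpen_compl.mem_nhds fun h => h.2 rfl)
  have h2 := (tendsto_cantorFunction_tail false s).eventually
    (lt_mem_nhds (sub_lt_self _ (half_pos hε)))
  obtain ⟨n, hn1, hn2⟩ := (h1.and h2).exists
  refine ⟨_, hairLength_tail_false_pos s n, fun x hx => ⟨?_, ?_⟩⟩
  · have : hairLength (tail false s n) < ε / 2 := by
      by_contra! h
      exact hn1 ⟨h, tail_ne hs n⟩
    linarith [hx.1]
  · exact hx.2.trans_lt (cantorFunction_tail_false_lt hs n)

theorem exists_gap_subset_Ioo (hc : IsCompact hairyCantor) {s : ℕ → Bool}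
    (hs : ¬ ∃ n, ∀ k ≥ n, s k = false) {ε : ℝ} (hε : 0 < ε) : ∃ H, IsGap cantorval H ∧
      H ⊆ Ioo (cantorFunction (1 / 3) s - ε) (cantorFunction (1 / 3) s) := by
  obtain ⟨u, hu, hus⟩ := exists_hair_subset_Ioo hs hε
  have hu' := hus (right_mem_Icc.2 (by linarith))
  obtain ⟨v, hv, hvs⟩ := exists_hair_subset_Ioo hs (sub_pos.2 hu'.2)
  rw [sub_sub_cancel] at hvs
  have hv' := hvs (left_mem_Icc.2 (by linarith))
  -- The gap through `y` is trapped between the base of the hair at `u` and the tip of the hair at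
  -- `v`.
  obtain ⟨y, hy, hy1, hy2⟩ := exists_notMem_left_of_hair hc hv hv'.1
  have hy' : y ∈ cantorvalᶜ := hy
  refine ⟨_, ⟨y, hy', rfl⟩, fun x hx => ⟨?_, ?_⟩⟩
  · by_contra! h
    exact connectedComponentIn_subset _ _ (isPreconnected_connectedComponentIn.ordConnected.out
      hx (mem_connectedComponentIn hy') ⟨h.trans hu'.1.le, hy1.le⟩) (cantorFunction_mem_cantorval u)
  · by_contra! h
    exact connectedComponentIn_subset _ _ (isPreconnected_connectedComponentIn.ordConnected.out
      (mem_connectedComponentIn hy') hx ⟨hy2.le, hv'.2.le.trans h⟩)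
      (layout_mem_cantorval hv.le le_rfl)

/-- Choose a point in each set. Were there finitely many, the hypothesis applied between the
rightmost chosen point and `a` would give a set further right. -/
theorem infinite_subset_Ioo {p : Set ℝ → Prop} {a : ℝ}
    (h : ∀ ε > 0, ∃ J, (p J ∧ J.Nonempty) ∧ J ⊆ Ioo (a - ε) a) {ε : ℝ} (hε : 0 < ε) :
    {J | p J ∧ J ⊆ Ioo (a - ε) a}.Infinite := by
  have key : {J : Set ℝ | (p J ∧ J.Nonempty) ∧ J ⊆ Ioo (a - ε) a}.Infinite := by
    intro hfin
    choose! c hc using fun J (hJ : J ∈ {J : Set ℝ | (p J ∧ J.Nonempty) ∧ J ⊆ Ioo (a - ε) a}) =>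
      hJ.1.2
    obtain ⟨J₀, hJ₀, hJ₀s⟩ := h ε hε
    obtain ⟨J, hJ, hmax⟩ := exists_max_image _ c hfin ⟨J₀, hJ₀, hJ₀s⟩
    have hcJ := hJ.2 (hc J hJ)
    obtain ⟨J', hJ', hJs'⟩ := h (a - c J) (sub_pos.2 hcJ.2)
    rw [sub_sub_cancel] at hJs'
    have hmem : J' ∈ {J : Set ℝ | (p J ∧ J.Nonempty) ∧ J ⊆ Ioo (a - ε) a} :=
      ⟨hJ', hJs'.trans (Ioo_subset_Ioo_left hcJ.1.le)⟩
    exact (hJs' (hc J' hmem)).1.not_ge (hmax J' hmem)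
  exact key.mono fun J hJ => ⟨hJ.1.1, hJ.2⟩

theorem IsGap.exists_Ico {K G : Set ℝ} (hK : IsClosed K) (hG : IsGap K G) {b : ℝ}
    (hb : IsLUB G b) : b ∈ K ∧ ∃ x < b, Ico x b ⊆ Kᶜ := by
  obtain ⟨x, hx, rfl⟩ := hG
  by_cases hk : ∃ k ∈ K, x < k
  · obtain ⟨k, hk, hxk⟩ := hk
    obtain ⟨b', hb', hxb, -, hI, hlub⟩ := exists_right_end hK hx hk hxk
    obtain rfl := hb.unique hlub
    exact ⟨hb', x, hxb, hI⟩
  · push Not at hk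
    have hsub : Ici x ⊆ Kᶜ := fun y hy hyK => hx ((hk y hyK).antisymm hy ▸ hyK)
    have := isPreconnected_Ici.subset_connectedComponentIn self_mem_Ici hsub
    exact absurd (hb.bddAbove.mono this) (not_bddAbove_Ici x)

theorem IsGap.exists_Ioc {K G : Set ℝ} (hK : IsClosed K) (hG : IsGap K G) {a : ℝ}
    (ha : IsGLB G a) : a ∈ K ∧ ∃ x > a, Ioc a x ⊆ Kᶜ := by
  obtain ⟨x, hx, rfl⟩ := hG
  by_cases hk : ∃ k ∈ K, k < x
  · obtain ⟨k, hk, hkx⟩ := hk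
    obtain ⟨a', ha', hax, -, hI, hglb⟩ := exists_left_end hK hx hk hkx
    obtain rfl := ha.unique hglb
    exact ⟨ha', x, hax, hI⟩
  · push Not at hk
    have hsub : Iic x ⊆ Kᶜ := fun y hy hyK => hx ((hk y hyK).antisymm' hy ▸ hyK)
    have := isPreconnected_Iic.subset_connectedComponentIn self_mem_Iic hsub
    exact absurd (ha.bddBelow.mono this) (not_bddBelow_Iic x)

theorem isLCantorval_cantorval (hc : IsCompact hairyCantor) : IsLCantorval cantorval where
  nonempty := ⟨_, cantorFunction_mem_cantorval fun _ => false⟩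
  isCompact := hc.image continuous_layout
  right := by
    intro G hG b hb
    obtain ⟨hbK, x, hxb, hI⟩ := hG.exists_Ico (hc.image continuous_layout).isClosed hb
    obtain ⟨s, hs1, hs2⟩ := exists_mem_hair hbK
    have hbs : b = cantorFunction (1 / 3) s - hairLength s := by
      refine hs1.antisymm' (not_lt.1 fun hlt => ?_)
      obtain ⟨y, hy1, hy2⟩ := exists_between (max_lt hlt hxb)
      rw [max_lt_iff] at hy1
      exact hI ⟨hy1.2.le, hy2⟩ (hair_subset_cantorval s ⟨hy1.1.le, hy2.le.trans hs2⟩)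
    by_cases hpos : 0 < hairLength s
    · exact ⟨_, isInterval_hair hc hpos, hbs ▸ isLeast_Icc (by linarith)⟩
    · have h0 : hairLength s = 0 := (hairLength_nonneg s).antisymm' (not_lt.1 hpos)
      rw [h0, sub_zero] at hbs
      rw [hairLength_pos_iff] at hpos
      subst hbs
      -- If no hair is attached at `s`, its truncations accumulate at `b` from the left, inside the
      -- supposed gap.
      obtain ⟨n, hn⟩ := ((tendsto_cantorFunction_tail false s).eventually (lt_mem_nhds hxb)).exists
      exact absurd (cantorFunction_mem_cantorval _)
        (hI ⟨hn.le, cantorFunction_tail_false_lt hpos n⟩)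
  left := by
    intro G hG a ha ε hε
    obtain ⟨haK, x, hax, hI⟩ := hG.exists_Ioc (hc.image continuous_layout).isClosed ha
    obtain ⟨s, hs1, hs2⟩ := exists_mem_hair haK
    have has : a = cantorFunction (1 / 3) s := by
      refine hs2.antisymm (not_lt.1 fun hlt => ?_)
      obtain ⟨y, hy1, hy2⟩ := exists_between (lt_min hlt hax)
      rw [lt_min_iff] at hy2
      exact hI ⟨hy1, hy2.2.le⟩ (hair_subset_cantorval s ⟨hs1.trans hy1.le, hy2.1.le⟩)
    subst has
    -- Otherwise replacing tails of `s` by `true` gives points accumulating at `a` from the right.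
    -- Being eventually `true`, `s` is not eventually `false`, so hairs and gaps accumulate at `a`
    -- from the left.
    have htrue : ∃ n, ∀ k ≥ n, s k = true := by
      by_contra hs
      obtain ⟨n, hn⟩ := ((tendsto_cantorFunction_tail true s).eventually (gt_mem_nhds hax)).exists
      exact absurd (cantorFunction_mem_cantorval _) (hI ⟨lt_cantorFunction_tail_true hs n, hn.le⟩)
    have hfalse : ¬ ∃ n, ∀ k ≥ n, s k = false := by
      rintro ⟨n, hn⟩
      obtain ⟨m, hm⟩ := htrue
      exact Bool.false_ne_true
        ((hn _ (le_max_left n m)).symm.trans (hm _ (le_max_right n m)))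
    refine ⟨infinite_subset_Ioo (fun δ hδ => ?_) hε, infinite_subset_Ioo (fun δ hδ => ?_) hε⟩
    · obtain ⟨u, hu, hus⟩ := exists_hair_subset_Ioo hfalse hδ
      exact ⟨_, ⟨isInterval_hair hc hu, (isInterval_hair hc hu).2.nonempty⟩, hus⟩
    · obtain ⟨H, hH, hHs⟩ := exists_gap_subset_Ioo hc hfalse hδ
      refine ⟨H, ⟨hH, ?_⟩, hHs⟩
      obtain ⟨y, hy, rfl⟩ := hH
      exact ⟨y, mem_connectedComponentIn hy⟩

theorem isSpecialLCantorval_cantorval (hc : IsCompact hairyCantor) :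
    IsSpecialLCantorval cantorval where
  toIsLCantorval := isLCantorval_cantorval hc
  left_free := by
    intro J hJ
    obtain ⟨s, hs, rfl⟩ := hJ.exists_hair hc
    refine ⟨⟨_, layout_mem_cantorval hs.le le_rfl⟩, isLeast_Icc (by linarith),
      ⟨⟨_, cantorFunction_mem_cantorval s⟩, isArc_of_image_eq_Icc (by simpa using hs) ?_⟩,
      mem_interior_iff_mem_nhds.2 (hair_mem_nhds hc hs _)⟩
    rw [Subtype.image_preimage_coe, inter_eq_right.2 (hair_subset_cantorval s)]
    rfl

end Existence

end SpecialCantorval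

theorem mainTheorem8 {X : Type*} [MetricSpace X] [CompactSpace X] [Nonempty X]
    (hstar : SpecialCantorval.ConditionStar X)
    (hdense : Dense (⋃₀ {S : Set X | SpecialCantorval.IsNontrivialComponent S}))
    (hfree : ∀ S : Set X, SpecialCantorval.IsNontrivialComponent S →
      ∃! e : X, SpecialCantorval.IsFreeEndpoint S e) :
    (∃ K : Set ℝ, SpecialCantorval.IsSpecialLCantorval K) ∧
      ∀ K : Set ℝ, SpecialCantorval.IsSpecialLCantorval K → Nonempty (X ≃ₜ K) := by
  have hX : SpecialCantorval.IsHairySpace X := ⟨hstar, hdense, hfree⟩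
  refine ⟨⟨_, SpecialCantorval.isSpecialLCantorval_cantorval hX.isCompact_hairyCantor⟩,
    fun K hK => ?_⟩
  have := hK.nonempty.to_subtype
  have := isCompact_iff_compactSpace.1 hK.isCompact
  obtain ⟨e⟩ := hX.nonempty_homeomorph_hairyCantor
  obtain ⟨e'⟩ := hK.isHairySpace.nonempty_homeomorph_hairyCantor
  exact ⟨e.trans e'.symm⟩
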